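/- Let $\mathbb{F}_q$ be a finite field with $q$ elements, $A=\mathbb{F}_q[t]$, $K=\mathbb{F}_q(t)$, and let $K_\infty=\mathbb{F}_q((1/t))$ be the completion of $K$ at the infinite place. For $d\ge 0$ and $s\in\mathbb{Z}$ put $S_d(s)=\sum_a a^{-s}\in K$, where $a$ runs over the monic polynomials of degree $d$ in $A$. For positive integers $s_1,\dots,s_r$ the multizeta value is $$\zeta(s_1,\dots,s_r)=\sum_{d_1>\cdots>d_r\ge 0}S_{d_1}(s_1)\cdots S_{d_r}(s_r)\in K_\infty .$$ Let $b\ge 1$ be an integer, put $r_1=q-1$, write $b=r_1\sigma+\beta$ with integers $\sigma\ge 0$ and $0<\beta\le r_1$, and put $\phi(i)=r_1-1+i\,r_1$. Then the indices $b-\phi(i)$ and $1+\phi(i)$ are positive for $0\le i\le\sigma-1$, all the series defining the multizeta values below converge in $K_\infty$, and $$\zeta(1)\,\zeta(b)=\zeta(1+b)+\zeta(1,b)+\zeta(b,1)+\sum_{i=0}^{\sigma-1}\zeta\bigl(b-\phi(i),\,1+\phi(i)\bigr).$$ -/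

import Mathlib

open Polynomial

noncomputable section

namespace CarlitzMultizeta

theorem finite_monic_natDegree_eq (F : Type*) [Field F] [Finite F] (d : ℕ) :
    {a : F[X] | a.Monic ∧ a.natDegree = d}.Finite := by
  have h : {a : F[X] | a.Monic ∧ a.natDegree = d} ⊆
      Set.range (fun c : Fin (d + 1) → F => ∑ i : Fin (d + 1), monomial (i : ℕ) (c i)) := by
    rintro a ⟨-, rfl⟩
    exact ⟨fun i => a.coeff i, by
      beta_reduce
      rw [Fin.sum_univ_eq_sum_range (fun i => monomial i (a.coeff i)) (a.natDegree + 1)]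
      exact a.as_sum_range.symm⟩
  exact (Set.finite_range _).subset h

/-- The finite set of monic polynomials of degree `d` in `A = F[t]`. -/
def monicsOfDegree (F : Type*) [Field F] [Finite F] (d : ℕ) : Finset F[X] :=
  (finite_monic_natDegree_eq F d).toFinset

/-- The power sum `S_d(s) = ∑ 1 / a ^ s` in `K = F(t)`, over the monic polynomials `a` of
degree `d`, for an integer `s`. -/
def powerSum (F : Type*) [Field F] [Finite F] (d : ℕ) (s : ℤ) : RatFunc F :=
  ∑ a ∈ monicsOfDegree F d, 1 / (algebraMap F[X] (RatFunc F) a) ^ s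

open Classical in
/-- The field `K_∞ = F((1/t))`, the completion of `K = F(t)` at infinity. Mathlib's construction
takes an instance of decidable equality, which is chosen classically here. -/
abbrev KInfty (F : Type*) [Field F] : Type _ := RatFunc.CompletionAtInfty F

/-- The term `S_{d₁}(s₁) ⋯ S_{d_r}(s_r)`, for degrees `d₁ > ⋯ > d_r ≥ 0`, of the series of a
multizeta value, viewed in `K_∞`. -/
def multizetaTerm (F : Type*) [Field F] [Finite F] {r : ℕ} (s : Fin r → ℤ)
    (d : {d : Fin r → ℕ // StrictAnti d}) : KInfty F :=
  algebraMap (RatFunc F) (KInfty F) (∏ i, powerSum F (d.1 i) (s i))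

/-- Convergence, in `K_∞`, of the series which defines the multizeta value `ζ(s₁, …, s_r)`. -/
def MultizetaConverges (F : Type*) [Field F] [Finite F] {r : ℕ} (s : Fin r → ℤ) : Prop :=
  Summable (multizetaTerm F s)

/-- Thakur's multizeta value
`ζ(s₁, …, s_r) = ∑_{d₁ > ⋯ > d_r ≥ 0} S_{d₁}(s₁) ⋯ S_{d_r}(s_r)` in `K_∞`. Depth `1` is the
Carlitz zeta value. -/
def multizeta (F : Type*) [Field F] [Finite F] {r : ℕ} (s : Fin r → ℤ) :
    KInfty F :=
  ∑' d : {d : Fin r → ℕ // StrictAnti d}, multizetaTerm F s d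

/-- The integer `φ(i) = r₁ - 1 + i r₁`, where `r₁ = q - 1`. -/
def phi (q i : ℕ) : ℤ :=
  ((q : ℤ) - 1) - 1 + (i : ℤ) * ((q : ℤ) - 1)

end CarlitzMultizeta

end

/-! Multiplying the two series and splitting the pairs of degrees by trichotomy gives ζ(1,b), ζ(b,1)
and the diagonal ∑ S_d(1) S_d(b) (`tsum_mul_tsum_eq_diag_add_lt_add_gt`), so everything rests on
Chen's finite formula `powerSum_one_mul_powerSum`. There the pairs of equal polynomials give
S_d(1+b). Any other pair is (x + n, x) with n nonzero of degree below d, and 1/(x^b (x+n)) is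
expanded in partial fractions (`inv_pow_mul_inv_add`). Writing n as a unit times a monic polynomial,
the sum of n^(-k) over all n vanishes unless q - 1 divides k, when it is -∑_{m<d} S_m(k)
(`sum_nonzeroOfDegreeLT_inv_pow`). The surviving exponents k = (q-1)(i+1) = 1 + φ(i) below b yield
the extra double zeta values. Convergence is ultrametric: S_d(s) tends to 0 for s > 0. -/

open Polynomial Filter Topology

noncomputable section

namespace CarlitzMultizeta

/-! ### Partial fractions -/

section PartialFractions

/-- Iterates 1/(x(x+n)) = (1/n)(1/x - 1/(x+n)). -/
theorem inv_pow_mul_inv_add {K : Type*} [Field K] {x n : K} (hx : x ≠ 0) (hn : n ≠ 0)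
    (hxn : x + n ≠ 0) (s : ℕ) :
    (x ^ s)⁻¹ * (x + n)⁻¹ =
      ∑ j ∈ Finset.range s, (-1) ^ j * (n ^ (j + 1))⁻¹ * (x ^ (s - j))⁻¹
        + (-1) ^ s * (n ^ s)⁻¹ * (x + n)⁻¹ := by
  induction s with
  | zero => simp
  | succ s ih =>
    have h : x⁻¹ * (x + n)⁻¹ = n⁻¹ * x⁻¹ - n⁻¹ * (x + n)⁻¹ := by
      field_simp
      ring
    have h1 : ∑ j ∈ Finset.range s, (-1) ^ j * (n ^ (j + 1))⁻¹ * (x ^ (s + 1 - j))⁻¹ =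
        (∑ j ∈ Finset.range s, (-1) ^ j * (n ^ (j + 1))⁻¹ * (x ^ (s - j))⁻¹) * x⁻¹ := by
      rw [Finset.sum_mul]
      refine Finset.sum_congr rfl fun j hj => ?_
      rw [Nat.sub_add_comm (Finset.mem_range.1 hj).le, pow_succ x, mul_inv]
      ring
    rw [Finset.sum_range_succ, h1, ← sub_eq_of_eq_add ih, pow_succ x, mul_inv, Nat.add_sub_cancel_left]
    linear_combination (-1) ^ s * (n ^ s)⁻¹ * h

end PartialFractions

/-! ### Monic polynomials and their differences -/

section Polynomials

variable (F : Type*) [Field F] [Finite F]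

@[simp]
theorem mem_monicsOfDegree {d : ℕ} {a : F[X]} :
    a ∈ monicsOfDegree F d ↔ a.Monic ∧ a.natDegree = d := by
  simp [monicsOfDegree]

variable {F} in
theorem ne_zero_of_mem_monicsOfDegree {d : ℕ} {a : F[X]} (ha : a ∈ monicsOfDegree F d) :
    a ≠ 0 :=
  ((mem_monicsOfDegree F).1 ha).1.ne_zero

theorem finite_ne_zero_natDegree_lt (d : ℕ) :
    {n : F[X] | n ≠ 0 ∧ n.natDegree < d}.Finite := by
  -- Adding `X ^ d` turns such an `n` into a monic polynomial of degree `d`.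
  refine ((finite_monic_natDegree_eq F d).image (· - X ^ d)).subset ?_
  rintro n ⟨h0, hd⟩
  have hdeg : n.degree < d := (natDegree_lt_iff_degree_lt h0).1 hd
  refine ⟨X ^ d + n, ⟨monic_X_pow_add hdeg, ?_⟩, by simp⟩
  rw [natDegree_add_eq_left_of_degree_lt (by rwa [degree_X_pow]), natDegree_X_pow]

/-- The nonzero polynomials of degree less than `d`. -/
def nonzeroOfDegreeLT (d : ℕ) : Finset F[X] :=
  (finite_ne_zero_natDegree_lt F d).toFinset

@[simp]
theorem mem_nonzeroOfDegreeLT {d : ℕ} {n : F[X]} :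
    n ∈ nonzeroOfDegreeLT F d ↔ n ≠ 0 ∧ n.natDegree < d := by
  simp [nonzeroOfDegreeLT]

variable {F} in
theorem add_mem_monicsOfDegree {d : ℕ} {a n : F[X]} (ha : a ∈ monicsOfDegree F d)
    (hn : n.degree < d) : a + n ∈ monicsOfDegree F d := by
  rw [mem_monicsOfDegree] at ha ⊢
  have h : n.degree < a.degree := by rwa [degree_eq_natDegree ha.1.ne_zero, ha.2]
  exact ⟨ha.1.add_of_left h, by rw [natDegree_add_eq_left_of_degree_lt h, ha.2]⟩

variable {F} in
theorem sub_mem_nonzeroOfDegreeLT {d : ℕ} {a b : F[X]} (ha : a ∈ monicsOfDegree F d)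
    (hb : b ∈ monicsOfDegree F d) (hab : a ≠ b) : a - b ∈ nonzeroOfDegreeLT F d := by
  rw [mem_monicsOfDegree] at ha hb
  rw [mem_nonzeroOfDegreeLT]
  refine ⟨sub_ne_zero.2 hab, ?_⟩
  rw [natDegree_lt_iff_degree_lt (sub_ne_zero.2 hab)]
  have h := degree_sub_lt_left (p := a) (q := b)
    (by rw [degree_eq_natDegree ha.1.ne_zero, degree_eq_natDegree hb.1.ne_zero, ha.2, hb.2])
    ha.1.ne_zero (by rw [ha.1.leadingCoeff, hb.1.leadingCoeff])
  rwa [degree_eq_natDegree ha.1.ne_zero, ha.2] at h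

variable {F} in
theorem degree_lt_of_mem_nonzeroOfDegreeLT {d : ℕ} {n : F[X]} (hn : n ∈ nonzeroOfDegreeLT F d) :
    n.degree < d :=
  have h := (mem_nonzeroOfDegreeLT F).1 hn
  (natDegree_lt_iff_degree_lt h.1).1 h.2

/-- For `b` monic of degree `d`, the other monic polynomials of degree `d` are the `b + n`. -/
theorem sum_erase_monicsOfDegree {M : Type*} [AddCommMonoid M] [DecidableEq F[X]] {d : ℕ}
    {b : F[X]} (hb : b ∈ monicsOfDegree F d) (f : F[X] → M) :
    ∑ a ∈ (monicsOfDegree F d).erase b, f a = ∑ n ∈ nonzeroOfDegreeLT F d, f (b + n) := by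
  refine Finset.sum_nbij' (· - b) (b + ·) ?_ ?_ ?_ ?_ ?_
  · intro a ha
    exact sub_mem_nonzeroOfDegreeLT (Finset.mem_of_mem_erase ha) hb (Finset.ne_of_mem_erase ha)
  · intro n hn
    refine Finset.mem_erase.2 ⟨?_, add_mem_monicsOfDegree hb (degree_lt_of_mem_nonzeroOfDegreeLT hn)⟩
    simpa using ((mem_nonzeroOfDegreeLT F).1 hn).1
  · intro a _; simp
  · intro n _; simp
  · intro a _; simp

theorem sum_monicsOfDegree_add {M : Type*} [AddCommMonoid M] {d : ℕ} {n : F[X]}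
    (hn : n.degree < d) (f : F[X] → M) :
    ∑ a ∈ monicsOfDegree F d, f (a + n) = ∑ a ∈ monicsOfDegree F d, f a := by
  refine Finset.sum_nbij' (· + n) (· - n) ?_ ?_ ?_ ?_ ?_
  · intro a ha; exact add_mem_monicsOfDegree ha hn
  · intro a ha
    simpa only [sub_eq_add_neg] using add_mem_monicsOfDegree ha (by rwa [degree_neg])
  · intro a _; simp
  · intro a _; simp
  · intro a _; rfl

/-- Every nonzero polynomial is uniquely a unit times a monic polynomial. -/
theorem sum_nonzeroOfDegreeLT [Fintype Fˣ] {M : Type*} [AddCommMonoid M] (d : ℕ) (f : F[X] → M) :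
    ∑ n ∈ nonzeroOfDegreeLT F d, f n =
      ∑ m ∈ Finset.range d, ∑ c ∈ monicsOfDegree F m, ∑ u : Fˣ, f (C (u : F) * c) := by
  simp_rw [Finset.sum_sigma']
  symm
  refine Finset.sum_bij (fun p _ => C (p.2.2 : F) * p.2.1) ?_ ?_ ?_ ?_
  · rintro ⟨m, c, u⟩ h
    simp only [Finset.mem_sigma, Finset.mem_range, mem_monicsOfDegree, Finset.mem_univ,
      and_true] at h
    rw [mem_nonzeroOfDegreeLT]
    refine ⟨mul_ne_zero (C_ne_zero.2 u.ne_zero) h.2.1.ne_zero, ?_⟩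
    rw [natDegree_C_mul u.ne_zero, h.2.2]
    exact h.1
  · rintro ⟨m, c, u⟩ h ⟨m', c', u'⟩ h' heq
    simp only [Finset.mem_sigma, Finset.mem_range, mem_monicsOfDegree, Finset.mem_univ,
      and_true] at h h' heq
    have hu : (u : F) = u' := by
      have := congrArg leadingCoeff heq
      simpa [leadingCoeff_mul, h.2.1.leadingCoeff, h'.2.1.leadingCoeff] using this
    have hc : c = c' := by
      rw [hu] at heq
      exact mul_left_cancel₀ (C_ne_zero.2 u'.ne_zero) heq
    obtain rfl : u = u' := Units.ext hu
    subst hc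
    obtain rfl : m = m' := h.2.2.symm.trans h'.2.2
    rfl
  · intro n hn
    rw [mem_nonzeroOfDegreeLT] at hn
    have hl : n.leadingCoeff ≠ 0 := leadingCoeff_ne_zero.2 hn.1
    refine ⟨⟨n.natDegree, C n.leadingCoeff⁻¹ * n, Units.mk0 _ hl⟩, ?_, ?_⟩
    · simp only [Finset.mem_sigma, Finset.mem_range, mem_monicsOfDegree, Finset.mem_univ, and_true]
      refine ⟨hn.2, ?_, natDegree_C_mul (inv_ne_zero hl)⟩
      rw [mul_comm]
      exact monic_mul_leadingCoeff_inv hn.1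
    · simp only [Units.val_mk0]
      rw [← mul_assoc, ← C_mul, mul_inv_cancel₀ hl, C_1, one_mul]
  · intros; rfl

end Polynomials

/-! ### Chen's formula for power sums -/

section PowerSums

variable (F : Type*) [Field F] [Fintype F]

theorem powerSum_natCast (d s : ℕ) :
    powerSum F d (s : ℤ) =
      ∑ a ∈ monicsOfDegree F d, ((algebraMap F[X] (RatFunc F) a) ^ s)⁻¹ := by
  simp [powerSum]

theorem sum_units_inv_pow (s : ℕ) [Fintype Fˣ] :
    ∑ u : Fˣ, ((u : F) ^ s)⁻¹ = if Fintype.card F - 1 ∣ s then -1 else 0 := by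
  classical
  -- Inversion permutes the units, so negative exponents reduce to positive ones.
  rw [← FiniteField.sum_pow_units F s, ← Equiv.sum_comp (Equiv.inv Fˣ)]
  refine Finset.sum_congr (Finset.ext fun u => by simp) fun u _ => by simp

theorem neg_one_pow_card_sub_one : (-1 : RatFunc F) ^ (Fintype.card F - 1) = 1 := by
  simpa using congrArg (algebraMap F (RatFunc F))
    (FiniteField.pow_card_sub_one_eq_one (-1 : F) (neg_ne_zero.2 one_ne_zero))

theorem sum_nonzeroOfDegreeLT_inv_pow (d s : ℕ) :
    ∑ n ∈ nonzeroOfDegreeLT F d, ((algebraMap F[X] (RatFunc F) n) ^ s)⁻¹ =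
      if Fintype.card F - 1 ∣ s then -∑ m ∈ Finset.range d, powerSum F m (s : ℤ) else 0 := by
  classical
  have h : ∀ c : F[X], ∑ u : Fˣ, ((algebraMap F[X] (RatFunc F) (C (u : F) * c)) ^ s)⁻¹ =
      algebraMap F (RatFunc F) (if Fintype.card F - 1 ∣ s then -1 else 0) *
        ((algebraMap F[X] (RatFunc F) c) ^ s)⁻¹ := by
    intro c
    rw [← sum_units_inv_pow, map_sum, Finset.sum_mul]
    refine Finset.sum_congr rfl fun u _ => ?_
    simp [mul_pow, mul_comm]
  rw [sum_nonzeroOfDegreeLT F d fun n => ((algebraMap F[X] (RatFunc F) n) ^ s)⁻¹]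
  simp_rw [h, powerSum_natCast, ← Finset.mul_sum]
  split_ifs <;> simp

theorem powerSum_one_mul_powerSum_sub (d s : ℕ) :
    powerSum F d 1 * powerSum F d (s : ℤ) - powerSum F d (1 + (s : ℤ)) =
      ∑ j ∈ Finset.range s, (-1) ^ j *
          (∑ n ∈ nonzeroOfDegreeLT F d, ((algebraMap F[X] (RatFunc F) n) ^ (j + 1))⁻¹) *
            powerSum F d ((s - j : ℕ) : ℤ)
        + (-1) ^ s * (∑ n ∈ nonzeroOfDegreeLT F d, ((algebraMap F[X] (RatFunc F) n) ^ s)⁻¹) *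
            powerSum F d 1 := by
  classical
  set φ := algebraMap F[X] (RatFunc F)
  have h1 : powerSum F d 1 = ∑ a ∈ monicsOfDegree F d, (φ a)⁻¹ := by
    simpa using powerSum_natCast F d 1
  have hs : powerSum F d (1 + (s : ℤ)) = ∑ a ∈ monicsOfDegree F d, (φ a ^ s)⁻¹ * (φ a)⁻¹ := by
    have := powerSum_natCast F d (s + 1)
    push_cast at this
    rw [add_comm, this]
    exact Finset.sum_congr rfl fun a _ => by rw [pow_succ, mul_inv]
  have key : powerSum F d 1 * powerSum F d (s : ℤ) - powerSum F d (1 + (s : ℤ)) =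
      ∑ b ∈ monicsOfDegree F d, ∑ n ∈ nonzeroOfDegreeLT F d, (φ b ^ s)⁻¹ * (φ b + φ n)⁻¹ := by
    rw [hs, h1, powerSum_natCast, mul_comm, Finset.sum_mul, ← Finset.sum_sub_distrib]
    refine Finset.sum_congr rfl fun b hb => ?_
    rw [← Finset.add_sum_erase _ _ hb, mul_add, add_sub_cancel_left,
      sum_erase_monicsOfDegree F hb, Finset.mul_sum]
    simp_rw [map_add]; rfl
  rw [key]
  have hpf : ∀ b ∈ monicsOfDegree F d, ∀ n ∈ nonzeroOfDegreeLT F d,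
      (φ b ^ s)⁻¹ * (φ b + φ n)⁻¹ =
        ∑ j ∈ Finset.range s, (-1) ^ j * (φ n ^ (j + 1))⁻¹ * (φ b ^ (s - j))⁻¹
          + (-1) ^ s * (φ n ^ s)⁻¹ * (φ b + φ n)⁻¹ := by
    intro b hb n hn
    refine inv_pow_mul_inv_add ?_ ?_ ?_ s
    · exact RatFunc.algebraMap_ne_zero (ne_zero_of_mem_monicsOfDegree hb)
    · exact RatFunc.algebraMap_ne_zero ((mem_nonzeroOfDegreeLT F).1 hn).1
    · rw [← map_add]
      exact RatFunc.algebraMap_ne_zero (ne_zero_of_mem_monicsOfDegree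
        (add_mem_monicsOfDegree hb (degree_lt_of_mem_nonzeroOfDegreeLT hn)))
  rw [Finset.sum_congr rfl fun b hb => Finset.sum_congr rfl (hpf b hb)]
  simp_rw [Finset.sum_add_distrib]
  congr 1
  · simp_rw [fun b => Finset.sum_comm (s := nonzeroOfDegreeLT F d) (t := Finset.range s)
      (f := fun n j => (-1) ^ j * (φ n ^ (j + 1))⁻¹ * (φ b ^ (s - j))⁻¹)]
    rw [Finset.sum_comm]
    refine Finset.sum_congr rfl fun j _ => ?_
    rw [powerSum_natCast, Finset.mul_sum]
    refine Finset.sum_congr rfl fun b _ => ?_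
    rw [Finset.mul_sum, Finset.sum_mul]
  · rw [Finset.sum_comm, Finset.mul_sum, Finset.sum_mul]
    refine Finset.sum_congr rfl fun n hn => ?_
    rw [← Finset.mul_sum, h1]
    congr 1
    simp_rw [← map_add]
    -- Translation by `n` permutes the monics of degree `d`, so the remainder gives S_d(1) for each
    -- `n`.
    exact sum_monicsOfDegree_add F (degree_lt_of_mem_nonzeroOfDegreeLT hn) fun a => (φ a)⁻¹

/-- Chen's formula for `S_d(1) S_d(b)`, with `b = r₁ σ + β` and `0 < β ≤ r₁`. -/
theorem powerSum_one_mul_powerSum {b σ β : ℕ} (hb : b = (Fintype.card F - 1) * σ + β)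
    (hβ_pos : 0 < β) (hβ_le : β ≤ Fintype.card F - 1) (d : ℕ) :
    powerSum F d 1 * powerSum F d (b : ℤ) = powerSum F d (1 + (b : ℤ)) +
      ∑ i ∈ Finset.range σ, powerSum F d ((b : ℤ) - phi (Fintype.card F) i) *
        ∑ m ∈ Finset.range d, powerSum F m (1 + phi (Fintype.card F) i) := by
  classical
  rw [← sub_eq_iff_eq_add', powerSum_one_mul_powerSum_sub]
  simp_rw [sum_nonzeroOfDegreeLT_inv_pow]
  set r := Fintype.card F - 1 with hr
  have hcard : Fintype.card F = r + 1 := by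
    have := Fintype.one_lt_card (α := F); omega
  obtain ⟨c, rfl⟩ : ∃ c, b = c + 1 := ⟨b - 1, by omega⟩
  rw [Finset.sum_range_succ, show c + 1 - c = 1 by omega]
  have hneg : (-1 : RatFunc F) ^ r = 1 := neg_one_pow_card_sub_one F
  -- The last partial fraction term, j = b - 1, cancels the remainder; hence only exponents j + 1 <
  -- b remain.
  have hcancel : ∀ x y : RatFunc F, (-1) ^ c * x * y + (-1) ^ (c + 1) * x * y = 0 := by
    intro x y
    rw [pow_succ]
    ring
  rw [Nat.cast_one, add_assoc, hcancel, add_zero]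
  have hterm : ∀ j ∈ Finset.range c,
      (-1) ^ j * (if r ∣ j + 1 then
          -∑ m ∈ Finset.range d, powerSum F m ((j + 1 : ℕ) : ℤ) else 0) *
            powerSum F d ((c + 1 - j : ℕ) : ℤ) =
        if r ∣ j + 1 then (-1) ^ (j + 1) * (∑ m ∈ Finset.range d, powerSum F m ((j + 1 : ℕ) : ℤ)) *
            powerSum F d ((c + 1 - j : ℕ) : ℤ) else 0 := by
    intro j _
    split_ifs
    · rw [pow_succ]
      ring
    · simp
  rw [Finset.sum_congr rfl hterm, ← Finset.sum_filter]
  symm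
  have hr_pos : 0 < r := by omega
  have hsucc : ∀ i, r * (i + 1) - 1 + 1 = r * (i + 1) := fun i =>
    Nat.sub_add_cancel (Nat.mul_pos hr_pos i.succ_pos)
  -- Multiples of r below b = rσ + β are r(i+1) with i < σ: `0 < β` admits i = σ - 1, and `β ≤ r`
  -- excludes i = σ.
  refine Finset.sum_bij (fun i _ => r * (i + 1) - 1) ?_ ?_ ?_ ?_
  · intro i hi
    have hle : r * (i + 1) ≤ r * σ := Nat.mul_le_mul_left r (Finset.mem_range.1 hi)
    rw [Finset.mem_filter, Finset.mem_range, hsucc]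
    exact ⟨by have := hsucc i; omega, dvd_mul_right _ _⟩
  · intro i _ i' _ h
    have h' : r * (i + 1) = r * (i' + 1) := by rw [← hsucc, ← hsucc i', h]
    simpa using Nat.eq_of_mul_eq_mul_left hr_pos h'
  · intro j hj
    rw [Finset.mem_filter, Finset.mem_range] at hj
    obtain ⟨k, hk⟩ := hj.2
    have hk0 : k ≠ 0 := by rintro rfl; simp at hk
    refine ⟨k - 1, Finset.mem_range.2 ?_, ?_⟩
    · by_contra hσ
      have hle : r * (σ + 1) ≤ r * k := Nat.mul_le_mul_left r (by omega)
      rw [Nat.mul_succ] at hle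
      omega
    · rw [Nat.sub_add_cancel (Nat.pos_of_ne_zero hk0), ← hk, Nat.add_sub_cancel]
  · intro i hi
    have hle : r * (i + 1) ≤ r * σ := Nat.mul_le_mul_left r (Finset.mem_range.1 hi)
    have hphi : phi (Fintype.card F) i = ((r * (i + 1) : ℕ) : ℤ) - 1 := by
      rw [phi, hcard]
      push_cast
      ring
    have hidx : ((c + 1 : ℕ) : ℤ) - phi (Fintype.card F) i =
        ((c + 1 - (r * (i + 1) - 1) : ℕ) : ℤ) := by
      have := hsucc i
      rw [hphi]
      omega
    rw [hsucc, pow_mul, hneg, one_pow, one_mul, hidx, hphi, add_sub_cancel, mul_comm]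

end PowerSums

/-! ### Ultrametric convergence in K_∞ -/

section Completion

open scoped Classical in
instance completeSpace_kInfty (F : Type*) [Field F] : CompleteSpace (KInfty F) :=
  @UniformSpace.Completion.completeSpace (RatFunc F) (RatFunc.inftyValued F).toUniformSpace

theorem nonarchimedeanRing_of_valued (R Γ₀ : Type*) [Ring R] [LinearOrderedCommGroupWithZero Γ₀]
    [hv : Valued R Γ₀] : NonarchimedeanRing R where
  is_nonarchimedean U hU := by
    obtain ⟨γ, hγ⟩ := Valued.mem_nhds_zero.1 hU
    refine ⟨⟨hv.v.restrict.ltAddSubgroup γ, ?_⟩, hγ⟩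
    exact AddSubgroup.isOpen_of_mem_nhds _ (g := 0) (Valued.mem_nhds_zero.2 ⟨γ, subset_rfl⟩)

open scoped Classical in
instance nonarchimedeanRing_kInfty (F : Type*) [Field F] : NonarchimedeanRing (KInfty F) :=
  nonarchimedeanRing_of_valued _ (WithZero (Multiplicative ℤ))

open scoped Classical in
theorem valued_algebraMap_kInfty {F : Type*} [Field F] (x : RatFunc F) :
    Valued.v (algebraMap (RatFunc F) (KInfty F) x) = RatFunc.inftyValuation F x := by
  rw [RatFunc.valuedCompletionAtInfty.def]
  let := RatFunc.inftyValued F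
  exact Valued.extensionValuation_apply_coe x

theorem tendsto_zero_of_valued_le_exp_neg {R : Type*} [Ring R]
    [hv : Valued R (WithZero (Multiplicative ℤ))] {f : ℕ → R}
    (hf : ∀ d, Valued.v (f d) ≤ WithZero.exp (-(d : ℤ))) : Tendsto f atTop (𝓝 0) := by
  intro U hU
  obtain ⟨γ, hγ⟩ := Valued.mem_nhds_zero.1 hU
  -- The radius lies in the value group of `v`; it is embedded so that its logarithm is an integer.
  set e := MonoidWithZeroHom.ValueGroup₀.embedding γ.val with he
  have he0 : e ≠ 0 := by simp [he]
  obtain ⟨N, hN⟩ := exists_nat_gt (-WithZero.log e)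
  refine mem_map.2 (mem_atTop_sets.2 ⟨N, fun d hd => hγ ?_⟩)
  change Valued.v.restrict (f d) < _
  rw [Valuation.restrict_lt_iff_lt_embedding]
  refine (hf d).trans_lt ?_
  rw [← he, ← WithZero.exp_log he0, WithZero.exp_lt_exp]
  have : (N : ℤ) ≤ d := by exact_mod_cast hd
  omega

open scoped Classical in
-- Each summand has valuation exp(-ds), and s ≥ 1.
theorem inftyValuation_powerSum_le (F : Type*) [Field F] [Finite F] (d : ℕ) {s : ℤ} (hs : 0 < s) :
    RatFunc.inftyValuation F (powerSum F d s) ≤ WithZero.exp (-(d : ℤ)) := by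
  refine Valuation.map_sum_le _ fun a ha => ?_
  have ha' : a.Monic ∧ a.natDegree = d := by simpa [monicsOfDegree] using ha
  have h : RatFunc.inftyValuation F (algebraMap F[X] (RatFunc F) a) = WithZero.exp (d : ℤ) := by
    rw [RatFunc.inftyValuation_apply, RatFunc.inftyValuation.polynomial F ha'.1.ne_zero, ha'.2]
  rw [map_div₀, map_one, map_zpow₀, h, one_div, ← WithZero.exp_zsmul, ← WithZero.exp_neg,
    WithZero.exp_le_exp]
  simp only [smul_eq_mul]
  nlinarith

variable (F : Type*) [Field F] [Finite F]

/-- `S_d(s)`, viewed in `K_∞`. -/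
def powerSumInfty (s : ℤ) (d : ℕ) : KInfty F :=
  algebraMap (RatFunc F) (KInfty F) (powerSum F d s)

theorem summable_powerSumInfty {s : ℤ} (hs : 0 < s) : Summable (powerSumInfty F s) := by
  classical
  refine NonarchimedeanAddGroup.summable_of_tendsto_cofinite_zero ?_
  rw [Nat.cofinite_eq_atTop]
  refine tendsto_zero_of_valued_le_exp_neg fun d => ?_
  rw [powerSumInfty, valued_algebraMap_kInfty]
  exact inftyValuation_powerSum_le F d hs

end Completion

/-! ### Depths one and two as sums over degrees -/

section Series

/-- The one-term strictly decreasing families of degrees. -/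
def strictAntiFinOneEquiv : {d : Fin 1 → ℕ // StrictAnti d} ≃ ℕ where
  toFun d := d.1 0
  invFun n := ⟨![n], Subsingleton.strictAnti _⟩
  left_inv d := by ext i; fin_cases i; rfl
  right_inv n := rfl

/-- The two-term strictly decreasing families of degrees. -/
def strictAntiFinTwoEquiv : {d : Fin 2 → ℕ // StrictAnti d} ≃ {p : ℕ × ℕ // p.2 < p.1} where
  toFun d := ⟨(d.1 0, d.1 1), d.2 (by decide)⟩
  invFun p := ⟨![p.1.1, p.1.2], by
    intro i j h
    fin_cases i <;> fin_cases j <;> first | exact absurd h (by decide) | exact p.2⟩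
  left_inv d := by ext i; fin_cases i <;> rfl
  right_inv p := rfl

variable (F : Type*) [Field F] [Finite F]

theorem multizetaTerm_one (s : ℤ) :
    multizetaTerm F ![s] = powerSumInfty F s ∘ strictAntiFinOneEquiv := by
  ext d
  simp [multizetaTerm, powerSumInfty]
  rfl

theorem multizetaTerm_two (s t : ℤ) :
    multizetaTerm F ![s, t] =
      (fun p : {p : ℕ × ℕ // p.2 < p.1} => powerSumInfty F s p.1.1 * powerSumInfty F t p.1.2) ∘
        strictAntiFinTwoEquiv := by
  ext d
  simp [multizetaTerm, powerSumInfty]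
  rfl

theorem multizetaConverges_one {s : ℤ} (hs : 0 < s) : MultizetaConverges F ![s] := by
  rw [MultizetaConverges, multizetaTerm_one, Equiv.summable_iff]
  exact summable_powerSumInfty F hs

theorem multizetaConverges_two {s t : ℤ} (hs : 0 < s) (ht : 0 < t) :
    MultizetaConverges F ![s, t] := by
  rw [MultizetaConverges, multizetaTerm_two, Equiv.summable_iff]
  exact ((summable_powerSumInfty F hs).mul_of_nonarchimedean
    (summable_powerSumInfty F ht)).subtype {p : ℕ × ℕ | p.2 < p.1}

theorem multizeta_one (s : ℤ) : multizeta F ![s] = ∑' d, powerSumInfty F s d := by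
  rw [multizeta, multizetaTerm_one]
  exact Equiv.tsum_eq strictAntiFinOneEquiv _

theorem multizeta_two (s t : ℤ) :
    multizeta F ![s, t] =
      ∑' p : {p : ℕ × ℕ // p.2 < p.1}, powerSumInfty F s p.1.1 * powerSumInfty F t p.1.2 := by
  rw [multizeta, multizetaTerm_two]
  exact Equiv.tsum_eq strictAntiFinTwoEquiv
    (fun p : {p : ℕ × ℕ // p.2 < p.1} => powerSumInfty F s p.1.1 * powerSumInfty F t p.1.2)

end Series

/-! ### Products of ultrametric series -/

section Product

variable {R : Type*} [Ring R] [UniformSpace R] [IsUniformAddGroup R] [NonarchimedeanRing R]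
  [CompleteSpace R] {f g : ℕ → R}

/-- Sums the family over p.2 < p.1 by rows; row d is supported on m < d, hence finite. -/
theorem hasSum_mul_sum_range (hf : Summable f) (hg : Summable g) :
    HasSum (fun d => f d * ∑ m ∈ Finset.range d, g m)
      (∑' p : {p : ℕ × ℕ // p.2 < p.1}, f p.1.1 * g p.1.2) := by
  have h := hf.mul_of_nonarchimedean hg
  have h1 : HasSum (Set.indicator {p : ℕ × ℕ | p.2 < p.1} fun p => f p.1 * g p.2)
      (∑' p : {p : ℕ × ℕ // p.2 < p.1}, f p.1.1 * g p.1.2) :=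
    hasSum_subtype_iff_indicator.1 (h.subtype {p : ℕ × ℕ | p.2 < p.1}).hasSum
  refine h1.prod_fiberwise fun d => ?_
  rw [Finset.mul_sum]
  have h2 : ∑ m ∈ Finset.range d, f d * g m = ∑ m ∈ Finset.range d,
      Set.indicator {p : ℕ × ℕ | p.2 < p.1} (fun p => f p.1 * g p.2) (d, m) :=
    Finset.sum_congr rfl fun m hm => by simp [Finset.mem_range.1 hm]
  rw [h2]
  refine hasSum_sum_of_ne_finset_zero fun m hm => ?_
  simpa using fun h => absurd (Finset.mem_range.2 h) hm

theorem tsum_mul_tsum_eq_diag_add_lt_add_gt [T2Space R] (hf : Summable f) (hg : Summable g) :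
    (∑' d, f d) * ∑' d, g d = ∑' d, f d * g d
      + ∑' p : {p : ℕ × ℕ // p.2 < p.1}, f p.1.1 * g p.1.2
      + ∑' p : {p : ℕ × ℕ // p.2 < p.1}, f p.1.2 * g p.1.1 := by
  have h := hf.mul_of_nonarchimedean hg
  rw [tsum_mul_tsum_of_nonarchimedean hf hg]
  have hlt := (h.subtype {p : ℕ × ℕ | p.2 < p.1}).hasSum
  have hgt := (h.subtype {p : ℕ × ℕ | p.1 < p.2}).hasSum
  have hdiag := (h.subtype {p : ℕ × ℕ | p.1 = p.2}).hasSum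
  have h1 : Disjoint {p : ℕ × ℕ | p.1 = p.2} {p : ℕ × ℕ | p.2 < p.1} :=
    Set.disjoint_left.2 fun p (hp : p.1 = p.2) (hp' : p.2 < p.1) => by omega
  have h2 : Disjoint ({p : ℕ × ℕ | p.1 = p.2} ∪ {p : ℕ × ℕ | p.2 < p.1}) {p | p.1 < p.2} :=
    Set.disjoint_left.2 fun p hp (hp' : p.1 < p.2) => by
      rcases hp with (hp : p.1 = p.2) | (hp : p.2 < p.1) <;> omega
  have h3 : ({p : ℕ × ℕ | p.1 = p.2} ∪ {p : ℕ × ℕ | p.2 < p.1}) ∪ {p | p.1 < p.2} = Set.univ := by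
    ext p
    rcases lt_trichotomy p.1 p.2 with h | h | h
    · exact iff_of_true (Or.inr h) trivial
    · exact iff_of_true (Or.inl (Or.inl h)) trivial
    · exact iff_of_true (Or.inl (Or.inr h)) trivial
  have hsum := (hdiag.add_disjoint h1 hlt).add_disjoint h2 hgt
  rw [h3] at hsum
  have := (hasSum_subtype_iff_indicator.1 hsum).tsum_eq
  rw [Set.indicator_univ] at this
  rw [this]
  let e₁ : ℕ ≃ {p : ℕ × ℕ | p.1 = p.2} :=
    ⟨fun d => ⟨(d, d), rfl⟩, fun p => p.1.1, fun _ => rfl, fun p => Subtype.ext (Prod.ext rfl p.2)⟩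
  let e₂ : {p : ℕ × ℕ // p.2 < p.1} ≃ {p : ℕ × ℕ | p.1 < p.2} :=
    ⟨fun p => ⟨(p.1.2, p.1.1), p.2⟩, fun p => ⟨(p.1.2, p.1.1), p.2⟩, fun _ => rfl, fun _ => rfl⟩
  exact congrArg₂ (· + ·) (congrArg₂ (· + ·) (e₁.tsum_eq _).symm rfl) (e₂.tsum_eq _).symm

end Product

theorem multizeta_one_mul_multizeta (F : Type*) [Field F] [Fintype F] {b σ β : ℕ}
    (hb : b = (Fintype.card F - 1) * σ + β) (hβ_pos : 0 < β) (hβ_le : β ≤ Fintype.card F - 1)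
    (hpos : ∀ i ∈ Finset.range σ,
      0 < (b : ℤ) - phi (Fintype.card F) i ∧ 0 < 1 + phi (Fintype.card F) i) :
    multizeta F ![1] * multizeta F ![(b : ℤ)] =
      multizeta F ![1 + (b : ℤ)] + multizeta F ![1, (b : ℤ)] + multizeta F ![(b : ℤ), 1]
        + ∑ i ∈ Finset.range σ, multizeta F
            ![(b : ℤ) - phi (Fintype.card F) i, 1 + phi (Fintype.card F) i] := by
  have hb0 : (0 : ℤ) < b := by omega
  have h1 := summable_powerSumInfty F one_pos
  have hbs := summable_powerSumInfty F hb0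
  have hdiag : ∀ d, powerSumInfty F 1 d * powerSumInfty F b d = powerSumInfty F (1 + b) d +
      ∑ i ∈ Finset.range σ, powerSumInfty F (b - phi (Fintype.card F) i) d *
        ∑ m ∈ Finset.range d, powerSumInfty F (1 + phi (Fintype.card F) i) m := by
    intro d
    simp_rw [powerSumInfty, ← map_sum, ← map_mul, ← map_sum, ← map_add]
    rw [powerSum_one_mul_powerSum F hb hβ_pos hβ_le]
  have hsum : HasSum (fun d => powerSumInfty F 1 d * powerSumInfty F b d)
      (multizeta F ![1 + (b : ℤ)] + ∑ i ∈ Finset.range σ, multizeta F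
        ![(b : ℤ) - phi (Fintype.card F) i, 1 + phi (Fintype.card F) i]) := by
    simp_rw [hdiag, multizeta_one, multizeta_two]
    refine (summable_powerSumInfty F (by omega)).hasSum.add (hasSum_sum fun i hi => ?_)
    exact hasSum_mul_sum_range (summable_powerSumInfty F (hpos i hi).1)
      (summable_powerSumInfty F (hpos i hi).2)
  rw [multizeta_one, multizeta_one, tsum_mul_tsum_eq_diag_add_lt_add_gt h1 hbs, hsum.tsum_eq,
    multizeta_two F 1, multizeta_two F b]
  simp_rw [mul_comm (powerSumInfty F 1 (Prod.snd _))]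
  ring

/-- Here 1 + φ(i) = (q-1)(i+1) ≤ (q-1)σ < b. -/
theorem index_pos {q b σ β : ℕ} (hq : 1 < q) (hb : b = (q - 1) * σ + β) (hβ_pos : 0 < β) {i : ℕ}
    (hi : i < σ) : 0 < (b : ℤ) - phi q i ∧ 0 < 1 + phi q i := by
  obtain ⟨r, rfl⟩ : ∃ r, q = r + 1 := ⟨q - 1, by omega⟩
  have hr : 0 < r := by omega
  have hle : r * (i + 1) ≤ r * σ := Nat.mul_le_mul_left r hi
  have hphi : phi (r + 1) i = ((r * (i + 1) : ℕ) : ℤ) - 1 := by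
    rw [phi]
    push_cast
    ring
  have : 0 < r * (i + 1) := Nat.mul_pos hr i.succ_pos
  rw [Nat.add_sub_cancel] at hb
  rw [hphi]
  omega

end CarlitzMultizeta

end

/-- The first four conjuncts say that all the multizeta values which occur have positive indices
and are given by convergent series; the last one is the identity. -/
theorem theorem7p3 (F : Type*) [Field F] [Fintype F] (q : ℕ) (hq : Fintype.card F = q)
    (b σ β : ℕ) (hb : b = (q - 1) * σ + β) (hβ_pos : 0 < β) (hβ_le : β ≤ q - 1) :
    (CarlitzMultizeta.MultizetaConverges F ![1] ∧
      CarlitzMultizeta.MultizetaConverges F ![(b : ℤ)] ∧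
      CarlitzMultizeta.MultizetaConverges F ![1 + (b : ℤ)]) ∧
    (CarlitzMultizeta.MultizetaConverges F ![1, (b : ℤ)] ∧
      CarlitzMultizeta.MultizetaConverges F ![(b : ℤ), 1]) ∧
    (∀ i ∈ Finset.range σ,
      0 < (b : ℤ) - CarlitzMultizeta.phi q i ∧ 0 < 1 + CarlitzMultizeta.phi q i) ∧
    (∀ i ∈ Finset.range σ, CarlitzMultizeta.MultizetaConverges F
      ![(b : ℤ) - CarlitzMultizeta.phi q i, 1 + CarlitzMultizeta.phi q i]) ∧
    CarlitzMultizeta.multizeta F ![1] * CarlitzMultizeta.multizeta F ![(b : ℤ)] =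
      CarlitzMultizeta.multizeta F ![1 + (b : ℤ)]
        + CarlitzMultizeta.multizeta F ![1, (b : ℤ)]
        + CarlitzMultizeta.multizeta F ![(b : ℤ), 1]
        + ∑ i ∈ Finset.range σ, CarlitzMultizeta.multizeta F
            ![(b : ℤ) - CarlitzMultizeta.phi q i, 1 + CarlitzMultizeta.phi q i] := by
  subst hq
  have hpos : ∀ i ∈ Finset.range σ, 0 < (b : ℤ) - CarlitzMultizeta.phi (Fintype.card F) i ∧
      0 < 1 + CarlitzMultizeta.phi (Fintype.card F) i := fun i hi =>
    CarlitzMultizeta.index_pos Fintype.one_lt_card hb hβ_pos (Finset.mem_range.1 hi)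
  have hb0 : (0 : ℤ) < b := by omega
  have hb1 : (0 : ℤ) < 1 + b := by omega
  exact ⟨⟨CarlitzMultizeta.multizetaConverges_one F one_pos,
      CarlitzMultizeta.multizetaConverges_one F hb0,
      CarlitzMultizeta.multizetaConverges_one F hb1⟩,
    ⟨CarlitzMultizeta.multizetaConverges_two F one_pos hb0,
      CarlitzMultizeta.multizetaConverges_two F hb0 one_pos⟩,
    hpos,
    fun i hi => CarlitzMultizeta.multizetaConverges_two F (hpos i hi).1 (hpos i hi).2,
    CarlitzMultizeta.multizeta_one_mul_multizeta F hb hβ_pos hβ_le hpos⟩
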